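/- **Tree width is equivalent to monoidal width in $\mathsf{Cospan}(\mathsf{UHGraph})_0$.** A *hypergraph* $G=(V,E,\mathrm{ends})$ consists of finite sets $V$ (vertices) and $E$ (edges) and a function $\mathrm{ends}\colon E\to\mathcal P(V)$. A *tree decomposition* of $G$ is a finite tree $Y$ with a set $t(i)\subseteq V$ for every node $i$ of $Y$, such that every vertex of $G$ lies in some $t(i)$, for every edge $e$ some $t(i)$ contains $\mathrm{ends}(e)$, and $t(i)\cap t(k)\subseteq t(j)$ whenever $j$ lies on the path in $Y$ from $i$ to $k$. Its width is $\max_i |t(i)|$ (without subtracting $1$), and the *tree width* $\mathrm{twd}(G)$ is the least width of a tree decomposition of $G$. Let $\mathsf{Cospan}(\mathsf{UHGraph})_0$ be the monoidal category whose objects are finite sets and whose morphisms $X\to Y$ are hypergraphs $G=(V,E,\mathrm{ends})$ with two functions $X\to V\leftarrow Y$, up to isomorphism of $G$ compatible with the two functions; composition is by pushout (along discrete hypergraphs) and the monoidal product $\otimes$ is the component-wise disjoint union, with unit $\emptyset$. A *monoidal decomposition* of a morphism $f$ is a binary tree whose leaves are labelled by arbitrary morphisms and whose internal nodes are labelled by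 $\otimes$ or by composition along an object $X$, and which evaluates to $f$. The *width* of a decomposition is the maximum of $|V|$ over all its leaves, where $V$ is the vertex set of the hypergraph of the leaf, and of $|X|$ over all its composition nodes along $X$ (nodes $\otimes$ cost $0$). The *monoidal width* $\mathrm{mwd}(f)$ is the least width of a monoidal decomposition of $f$. Then tree width and monoidal width are within constant factors of each other. Precisely, let $G$ be a hypergraph and let $g=(\emptyset\to G\leftarrow\emptyset)$ be the corresponding morphism of $\mathsf{Cospan}(\mathsf{UHGraph})_0$. Then $$\tfrac13\,\mathrm{twd}(G)\;\le\;\mathrm{mwd}(g)\;\le\;\mathrm{twd}(G)+1,\qquad\text{and}\qquad \mathrm{mwd}(g)\le 2\,\mathrm{twd}(G).$$ -/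

import Mathlib

open CategoryTheory MonoidalCategory

universe u v

/-! ## Monoidal decompositions and monoidal width -/

section MonoidalWidth

variable {C : Type u} [Category.{v} C] [MonoidalCategory C]

/-- Monoidal decompositions of a morphism, with atomic morphisms `A`: binary trees with leaves
labelled by atoms and nodes labelled by the monoidal product or by composition along an object,
that evaluate to the given morphism. -/
inductive MonoidalDecomposition (A : MorphismProperty C) :
    {X Y : C} → (X ⟶ Y) → Type (max u v)
  | leaf {X Y : C} (f : X ⟶ Y) (hf : A f) : MonoidalDecomposition A f
  | tensor {X₁ Y₁ X₂ Y₂ : C} {f₁ : X₁ ⟶ Y₁} {f₂ : X₂ ⟶ Y₂}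
      (d₁ : MonoidalDecomposition A f₁) (d₂ : MonoidalDecomposition A f₂) :
      MonoidalDecomposition A (f₁ ⊗ₘ f₂)
  | comp {X Y Z : C} {f₁ : X ⟶ Y} {f₂ : Y ⟶ Z}
      (d₁ : MonoidalDecomposition A f₁) (d₂ : MonoidalDecomposition A f₂) :
      MonoidalDecomposition A (f₁ ≫ f₂)

/-- A weight function for `(C, A)`: a weight for every object (the cost of composing along it) and
for every atom; the weight of the monoidal product operation is `0`. -/
structure WeightFunction (A : MorphismProperty C) where
  obj : C → ℕ
  atom : ∀ {X Y : C} (f : X ⟶ Y), A f → ℕ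
  obj_tensor : ∀ X Y : C, obj (X ⊗ Y) = obj X + obj Y

/-- The width of a monoidal decomposition. -/
def MonoidalDecomposition.width {A : MorphismProperty C} (w : WeightFunction A) :
    {X Y : C} → {f : X ⟶ Y} → MonoidalDecomposition A f → ℕ
  | _, _, _, .leaf f hf => w.atom f hf
  | _, _, _, .tensor d₁ d₂ => max (d₁.width w) (d₂.width w)
  | _, _, _, .comp (Y := Y) d₁ d₂ => max (d₁.width w) (max (w.obj Y) (d₂.width w))

/-- The monoidal width of a morphism: the least width of one of its monoidal decompositions.
(The atoms are assumed to be numerous enough for every morphism to have a decomposition.) -/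
noncomputable def monoidalWidth {A : MorphismProperty C} (w : WeightFunction A)
    {X Y : C} (f : X ⟶ Y) : ℕ :=
  ⨅ d : MonoidalDecomposition A f, d.width w

end MonoidalWidth

/-! ## Hypergraphs and tree width -/

/-- A finite undirected multihypergraph: finite sets of vertices and of edges, and for every edge
the set of its endpoints. -/
structure UHGraph where
  V : Type u
  E : Type u
  [finV : Finite V]
  [finE : Finite E]
  ends : E → Set V

attribute [instance] UHGraph.finV UHGraph.finE

namespace UHGraph

/-- Hypergraph homomorphisms. -/
@[ext]
structure Hom (G H : UHGraph.{u}) where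
  vMap : G.V → H.V
  eMap : G.E → H.E
  ends_eMap : ∀ e, H.ends (eMap e) = vMap '' G.ends e

instance : Category UHGraph.{u} where
  Hom := Hom
  id G := ⟨id, id, by simp⟩
  comp a b := ⟨b.vMap ∘ a.vMap, b.eMap ∘ a.eMap, fun e => by
    simp [b.ends_eMap, a.ends_eMap, Set.image_image]⟩

/-- The discrete hypergraph on a finite set. -/
@[reducible] def discrete (X : Type u) [Finite X] : UHGraph.{u} where
  V := X
  E := PEmpty
  ends := PEmpty.elim

/-- A function into the vertices of `G`, as a homomorphism from a discrete hypergraph; all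
homomorphisms from a discrete hypergraph are of this form. -/
def ofDiscrete {X : Type u} [Finite X] {G : UHGraph.{u}} (f : X → G.V) : discrete X ⟶ G where
  vMap := f
  eMap := PEmpty.elim
  ends_eMap e := e.elim

/-- A tree decomposition of a hypergraph. -/
structure TreeDecomposition (G : UHGraph.{u}) where
  Y : Type
  [finY : Finite Y]
  tree : SimpleGraph Y
  isTree : tree.IsTree
  bag : Y → Set G.V
  exists_mem_bag : ∀ x : G.V, ∃ i, x ∈ bag i
  exists_ends_subset_bag : ∀ e : G.E, ∃ i, G.ends e ⊆ bag i
  inter_subset_bag : ∀ (i k : Y) (p : tree.Walk i k), p.IsPath →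
    ∀ j ∈ p.support, bag i ∩ bag k ⊆ bag j

attribute [instance] TreeDecomposition.finY

/-- The width of a tree decomposition: the largest cardinality of a bag (not lowered by one). -/
noncomputable def TreeDecomposition.width {G : UHGraph.{u}} (T : TreeDecomposition G) : ℕ :=
  ⨆ i : T.Y, (T.bag i).ncard

instance (G : UHGraph.{u}) : Nonempty (TreeDecomposition G) :=
  ⟨{ Y := Unit
     tree := ⊥
     isTree := SimpleGraph.IsTree.of_subsingleton
     bag := fun _ => Set.univ
     exists_mem_bag := by simp
     exists_ends_subset_bag := by simp
     inter_subset_bag := by simp }⟩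

/-- The tree width of a hypergraph: the least width of one of its tree decompositions. -/
noncomputable def treeWidth (G : UHGraph.{u}) : ℕ :=
  ⨅ T : TreeDecomposition G, T.width

end UHGraph

/-! ## The monoidal category of cospans of hypergraphs with discrete boundaries -/

/-- A cospan of hypergraphs from the discrete hypergraph on `X` to the one on `Y`. -/
structure OpenUHGraph (X Y : Type u) where
  apex : UHGraph.{u}
  left : X → apex.V
  right : Y → apex.V

namespace OpenUHGraph

open Function

variable {X Y Z W X' Y' Z' : Type u}

/-- Isomorphism of cospans: an isomorphism of the apexes that is compatible with both legs. -/
def Iso (g h : OpenUHGraph X Y) : Prop :=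
  ∃ (a : g.apex.V ≃ h.apex.V) (b : g.apex.E ≃ h.apex.E),
    (∀ e, h.apex.ends (b e) = a '' g.apex.ends e) ∧
    (∀ x, a (g.left x) = h.left x) ∧ ∀ y, a (g.right y) = h.right y

instance setoid (X Y : Type u) : Setoid (OpenUHGraph X Y) where
  r := Iso
  iseqv :=
    { refl := fun g => ⟨.refl _, .refl _, by simp, by simp, by simp⟩
      symm := by
        rintro g h ⟨a, b, h₁, h₂, h₃⟩
        refine ⟨a.symm, b.symm, fun e => ?_, fun x => ?_, fun y => ?_⟩
        · obtain ⟨e, rfl⟩ := b.surjective e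
          simp [h₁, Set.image_image]
        · simp [← h₂]
        · simp [← h₃]
      trans := by
        rintro g h k ⟨a, b, h₁, h₂, h₃⟩ ⟨a', b', h₁', h₂', h₃'⟩
        refine ⟨a.trans a', b.trans b', fun e => ?_, fun x => ?_, fun y => ?_⟩
        · simp [h₁, h₁', Set.image_image]
        · simp [h₂, h₂']
        · simp [h₃, h₃'] }

/-- The cospan `X → Y ← Y` given by a function and the identity. -/
@[reducible] def ofFun [Finite Y] (f : X → Y) : OpenUHGraph X Y where
  apex := .discrete Y
  left := f
  right := id

/-- The relation that identifies the two vertices given by each common source. -/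
@[reducible] def glueRel (g : OpenUHGraph X Y) (h : OpenUHGraph Y Z) (p q : g.apex.V ⊕ h.apex.V) : Prop :=
  ∃ y, p = .inl (g.right y) ∧ q = .inr (h.left y)

/-- The pushout of two cospans along their common boundary. -/
@[reducible] def glue (g : OpenUHGraph X Y) (h : OpenUHGraph Y Z) : UHGraph.{u} where
  V := Quot (glueRel g h)
  E := g.apex.E ⊕ h.apex.E
  ends := Sum.elim (fun e => (fun p => Quot.mk _ (Sum.inl p)) '' g.apex.ends e)
    (fun e => (fun p => Quot.mk _ (Sum.inr p)) '' h.apex.ends e)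

/-- Composition of cospans by pushout. -/
@[reducible] def comp (g : OpenUHGraph X Y) (h : OpenUHGraph Y Z) : OpenUHGraph X Z where
  apex := glue g h
  left x := Quot.mk _ (.inl (g.left x))
  right z := Quot.mk _ (.inr (h.right z))

theorem glue_sound (g : OpenUHGraph X Y) (h : OpenUHGraph Y Z) (y : Y) :
    Quot.mk (glueRel g h) (.inl (g.right y)) = Quot.mk (glueRel g h) (.inr (h.left y)) :=
  Quot.sound ⟨y, rfl, rfl⟩

/-- The gluing used in composition is the pushout in the category of hypergraphs. -/
theorem isPushout_glue [Finite Y] (g : OpenUHGraph X Y) (h : OpenUHGraph Y Z) :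
    IsPushout (UHGraph.ofDiscrete g.right) (UHGraph.ofDiscrete h.left)
      (⟨fun p => Quot.mk _ (.inl p), .inl, fun _ => rfl⟩ : UHGraph.Hom g.apex (glue g h))
      (⟨fun p => Quot.mk _ (.inr p), .inr, fun _ => rfl⟩ : UHGraph.Hom h.apex (glue g h)) := by
  refine ⟨⟨?_⟩, ⟨Limits.PushoutCocone.IsColimit.mk _ (fun s =>
    (⟨Quot.lift (Sum.elim s.inl.vMap s.inr.vMap) ?_, Sum.elim s.inl.eMap s.inr.eMap, ?_⟩ :
      UHGraph.Hom (glue g h) s.pt)) ?_ ?_ ?_⟩⟩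
  · apply UHGraph.Hom.ext
    · funext y; exact glue_sound g h y
    · funext e; exact e.elim
  · rintro _ _ ⟨y, rfl, rfl⟩
    exact congrFun (congrArg UHGraph.Hom.vMap s.condition) y
  · rintro (e | e)
    · simp only [glue, Sum.elim_inl, Set.image_image]; exact s.inl.ends_eMap e
    · simp only [glue, Sum.elim_inr, Set.image_image]; exact s.inr.ends_eMap e
  · intro s; rfl
  · intro s; rfl
  · intro s m h₁ h₂
    apply UHGraph.Hom.ext
    · funext p
      induction p using Quot.ind with
      | mk p =>
        rcases p with p | p
        · exact congrFun (congrArg UHGraph.Hom.vMap h₁) p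
        · exact congrFun (congrArg UHGraph.Hom.vMap h₂) p
    · funext e
      rcases e with e | e
      · exact congrFun (congrArg UHGraph.Hom.eMap h₁) e
      · exact congrFun (congrArg UHGraph.Hom.eMap h₂) e

/-- The component-wise coproduct of two cospans. -/
@[reducible] def tensor (g : OpenUHGraph X Y) (h : OpenUHGraph X' Y') :
    OpenUHGraph (X ⊕ X') (Y ⊕ Y') where
  apex :=
    { V := g.apex.V ⊕ h.apex.V
      E := g.apex.E ⊕ h.apex.E
      ends := Sum.elim (fun e => Sum.inl '' g.apex.ends e) (fun e => Sum.inr '' h.apex.ends e) }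
  left := Sum.map g.left h.left
  right := Sum.map g.right h.right

theorem comp_congr {g g' : OpenUHGraph X Y} {h h' : OpenUHGraph Y Z} (hg : g ≈ g') (hh : h ≈ h') :
    g.comp h ≈ g'.comp h' := by
  obtain ⟨a, b, h₁, h₂, h₃⟩ := hg
  obtain ⟨a', b', h₁', h₂', h₃'⟩ := hh
  refine ⟨Quot.congr (a.sumCongr a') ?_, b.sumCongr b', ?_, ?_, ?_⟩
  · intro p q
    constructor
    · rintro ⟨y, rfl, rfl⟩
      exact ⟨y, by simp [h₃], by simp [h₂']⟩
    · rintro ⟨y, hp, hq⟩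
      refine ⟨y, (a.sumCongr a').injective ?_, (a.sumCongr a').injective ?_⟩
      · simp [hp, h₃]
      · simp [hq, h₂']
  · rintro (e | e)
    · change (fun p => Quot.mk _ (Sum.inl p)) '' g'.apex.ends (b e) =
        _ '' ((fun p => Quot.mk _ (Sum.inl p)) '' g.apex.ends e)
      rw [h₁, Set.image_image, Set.image_image]
      rfl
    · change (fun p => Quot.mk _ (Sum.inr p)) '' h'.apex.ends (b' e) =
        _ '' ((fun p => Quot.mk _ (Sum.inr p)) '' h.apex.ends e)
      rw [h₁', Set.image_image, Set.image_image]
      rfl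
  · intro x; exact congrArg (fun p => Quot.mk _ (Sum.inl p)) (h₂ x)
  · intro z; exact congrArg (fun p => Quot.mk _ (Sum.inr p)) (h₃' z)

theorem tensor_congr {g g' : OpenUHGraph X Y} {h h' : OpenUHGraph X' Y'}
    (hg : g ≈ g') (hh : h ≈ h') : g.tensor h ≈ g'.tensor h' := by
  obtain ⟨a, b, h₁, h₂, h₃⟩ := hg
  obtain ⟨a', b', h₁', h₂', h₃'⟩ := hh
  refine ⟨a.sumCongr a', b.sumCongr b', ?_, ?_, ?_⟩
  · rintro (e | e)
    · change Sum.inl '' g'.apex.ends (b e) = _ '' (Sum.inl '' g.apex.ends e)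
      rw [h₁, Set.image_image, Set.image_image]
      rfl
    · change Sum.inr '' h'.apex.ends (b' e) = _ '' (Sum.inr '' h.apex.ends e)
      rw [h₁', Set.image_image, Set.image_image]
      rfl
  · rintro (x | x)
    · exact congrArg Sum.inl (h₂ x)
    · exact congrArg Sum.inr (h₂' x)
  · rintro (y | y)
    · exact congrArg Sum.inl (h₃ y)
    · exact congrArg Sum.inr (h₃' y)

/-- Precomposing with a function changes the left leg. -/
theorem ofFun_comp [Finite Y] (f : X → Y) (h : OpenUHGraph Y Z) :
    (ofFun f).comp h ≈ ⟨h.apex, h.left ∘ f, h.right⟩ := by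
  refine ⟨⟨Quot.lift (Sum.elim h.left id) ?_, fun p => Quot.mk _ (.inr p), ?_, fun _ => rfl⟩,
    ⟨Sum.elim PEmpty.elim id, .inr, ?_, fun _ => rfl⟩, ?_, fun _ => rfl, fun _ => rfl⟩
  · rintro _ _ ⟨y, rfl, rfl⟩; rfl
  · rintro ⟨p | p⟩
    · exact (glue_sound (ofFun f) h p).symm
    · rfl
  · rintro (e | e)
    · exact e.elim
    · rfl
  · rintro (e | e)
    · exact e.elim
    · change h.apex.ends e = _ '' ((fun p => Quot.mk _ (Sum.inr p)) '' h.apex.ends e)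
      rw [Set.image_image]
      exact (Set.image_id _).symm

/-- Postcomposing with a bijection changes the right leg. -/
theorem comp_ofFun [Finite Z] (g : OpenUHGraph X Y) (f : Y ≃ Z) :
    g.comp (ofFun f) ≈ ⟨g.apex, g.left, g.right ∘ f.symm⟩ := by
  refine ⟨⟨Quot.lift (Sum.elim id (g.right ∘ f.symm)) ?_, fun p => Quot.mk _ (.inl p),
    ?_, fun _ => rfl⟩, ⟨Sum.elim id PEmpty.elim, .inl, ?_, fun _ => rfl⟩, ?_,
    fun _ => rfl, fun _ => rfl⟩
  · rintro _ _ ⟨y, rfl, rfl⟩; exact congrArg g.right (f.symm_apply_apply y).symm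
  · rintro ⟨p | p⟩
    · rfl
    · exact (glue_sound g (ofFun f) (f.symm p)).trans
        (congrArg (fun p => Quot.mk _ (Sum.inr p)) (f.apply_symm_apply p))
  · rintro (e | e)
    · rfl
    · exact e.elim
  · rintro (e | e)
    · change g.apex.ends e = _ '' ((fun p => Quot.mk _ (Sum.inl p)) '' g.apex.ends e)
      rw [Set.image_image]
      exact (Set.image_id _).symm
    · exact e.elim

theorem comp_assoc (g : OpenUHGraph X Y) (h : OpenUHGraph Y Z) (k : OpenUHGraph Z W) :
    (g.comp h).comp k ≈ g.comp (h.comp k) := by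
  refine ⟨⟨Quot.lift (Sum.elim (Quot.lift (Sum.elim (fun p => Quot.mk _ (.inl p))
      (fun p => Quot.mk _ (.inr (Quot.mk _ (.inl p))))) ?_)
      (fun p => Quot.mk _ (.inr (Quot.mk _ (.inr p))))) ?_,
    Quot.lift (Sum.elim (fun p => Quot.mk _ (.inl (Quot.mk _ (.inl p))))
      (Quot.lift (Sum.elim (fun p => Quot.mk _ (.inl (Quot.mk _ (.inr p))))
      (fun p => Quot.mk _ (.inr p))) ?_)) ?_, ?_, ?_⟩,
    Equiv.sumAssoc _ _ _, ?_, fun _ => rfl, fun _ => rfl⟩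
  · rintro _ _ ⟨y, rfl, rfl⟩; exact glue_sound g (h.comp k) y
  · rintro _ _ ⟨y, rfl, rfl⟩; exact congrArg (fun p => Quot.mk _ (Sum.inr p)) (glue_sound h k y)
  · rintro _ _ ⟨y, rfl, rfl⟩; exact glue_sound (g.comp h) k y
  · rintro _ _ ⟨y, rfl, rfl⟩; exact congrArg (fun p => Quot.mk _ (Sum.inl p)) (glue_sound g h y)
  · rintro ⟨⟨⟨p | p⟩⟩ | p⟩ <;> rfl
  · rintro ⟨p | ⟨⟨p | p⟩⟩⟩ <;> rfl
  · rintro ((e | e) | e)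
    · change _ = _ '' ((fun p => Quot.mk _ (Sum.inl p)) ''
        ((fun p => Quot.mk _ (Sum.inl p)) '' g.apex.ends e))
      rw [Set.image_image, Set.image_image]; rfl
    · change _ '' ((fun p => Quot.mk _ (Sum.inl p)) '' h.apex.ends e) =
        _ '' ((fun p => Quot.mk _ (Sum.inl p)) ''
          ((fun p => Quot.mk _ (Sum.inr p)) '' h.apex.ends e))
      rw [Set.image_image, Set.image_image, Set.image_image]; rfl
    · change _ '' ((fun p => Quot.mk _ (Sum.inr p)) '' k.apex.ends e) =
        _ '' ((fun p => Quot.mk _ (Sum.inr p)) '' k.apex.ends e)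
      rw [Set.image_image, Set.image_image]; rfl

theorem tensor_comp (g : OpenUHGraph X Y) (h : OpenUHGraph Y Z)
    (g' : OpenUHGraph X' Y') (h' : OpenUHGraph Y' Z') :
    (g.tensor g').comp (h.tensor h') ≈ (g.comp h).tensor (g'.comp h') := by
  refine ⟨⟨Quot.lift (Sum.elim
      (Sum.map (fun p => Quot.mk _ (.inl p)) (fun p => Quot.mk _ (.inl p)))
      (Sum.map (fun p => Quot.mk _ (.inr p)) (fun p => Quot.mk _ (.inr p)))) ?_,
    Sum.elim
      (Quot.lift (Sum.elim (fun p => Quot.mk _ (.inl (.inl p)))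
        (fun p => Quot.mk _ (.inr (.inl p)))) ?_)
      (Quot.lift (Sum.elim (fun p => Quot.mk _ (.inl (.inr p)))
        (fun p => Quot.mk _ (.inr (.inr p)))) ?_), ?_, ?_⟩,
    Equiv.sumSumSumComm _ _ _ _, ?_, ?_, ?_⟩
  · rintro _ _ ⟨y | y, rfl, rfl⟩
    · exact congrArg Sum.inl (glue_sound g h y)
    · exact congrArg Sum.inr (glue_sound g' h' y)
  · rintro _ _ ⟨y, rfl, rfl⟩; exact glue_sound (g.tensor g') (h.tensor h') (.inl y)
  · rintro _ _ ⟨y, rfl, rfl⟩; exact glue_sound (g.tensor g') (h.tensor h') (.inr y)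
  · rintro ⟨(p | p) | (p | p)⟩ <;> rfl
  · rintro (⟨⟨p | p⟩⟩ | ⟨⟨p | p⟩⟩) <;> rfl
  · rintro ((e | e) | (e | e))
    · change Sum.inl '' ((fun p => Quot.mk _ (Sum.inl p)) '' g.apex.ends e) =
        _ '' ((fun p => Quot.mk _ (Sum.inl p)) '' (Sum.inl '' g.apex.ends e))
      rw [Set.image_image, Set.image_image, Set.image_image]; rfl
    · change Sum.inr '' ((fun p => Quot.mk _ (Sum.inl p)) '' g'.apex.ends e) =
        _ '' ((fun p => Quot.mk _ (Sum.inl p)) '' (Sum.inr '' g'.apex.ends e))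
      rw [Set.image_image, Set.image_image, Set.image_image]; rfl
    · change Sum.inl '' ((fun p => Quot.mk _ (Sum.inr p)) '' h.apex.ends e) =
        _ '' ((fun p => Quot.mk _ (Sum.inr p)) '' (Sum.inl '' h.apex.ends e))
      rw [Set.image_image, Set.image_image, Set.image_image]; rfl
    · change Sum.inr '' ((fun p => Quot.mk _ (Sum.inr p)) '' h'.apex.ends e) =
        _ '' ((fun p => Quot.mk _ (Sum.inr p)) '' (Sum.inr '' h'.apex.ends e))
      rw [Set.image_image, Set.image_image, Set.image_image]; rfl
  · rintro (x | x) <;> rfl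
  · rintro (x | x) <;> rfl

theorem tensor_ofFun [Finite Y] [Finite Y'] (f : X → Y) (f' : X' → Y') :
    (ofFun f).tensor (ofFun f') ≈ ofFun (Sum.map f f') :=
  ⟨.refl _, Equiv.equivOfIsEmpty (PEmpty ⊕ PEmpty) PEmpty,
    by rintro (e | e) <;> exact e.elim, fun _ => rfl, by rintro (y | y) <;> rfl⟩

end OpenUHGraph

/-- Objects of the category of cospans of hypergraphs with discrete boundaries: finite sets. -/
structure CospanUHGraph where
  of ::
  carrier : Type u
  [finite : Finite carrier]

attribute [instance] CospanUHGraph.finite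

namespace CospanUHGraph

open OpenUHGraph

/-- Morphisms are isomorphism classes of cospans, composed by pushout. -/
instance : Category CospanUHGraph.{u} where
  Hom X Y := Quotient (OpenUHGraph.setoid X.carrier Y.carrier)
  id X := ⟦ofFun id⟧
  comp := Quotient.map₂ comp fun _ _ h _ _ h' => comp_congr h h'
  id_comp := by rintro X Y ⟨g⟩; exact Quotient.sound (ofFun_comp id g)
  comp_id := by rintro X Y ⟨g⟩; exact Quotient.sound (comp_ofFun g (Equiv.refl _))
  assoc := by rintro W X Y Z ⟨g⟩ ⟨h⟩ ⟨k⟩; exact Quotient.sound (comp_assoc g h k)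

/-- The morphism represented by a cospan. -/
def mk {X Y : CospanUHGraph.{u}} (g : OpenUHGraph X.carrier Y.carrier) : X ⟶ Y :=
  Quotient.mk _ g

/-- The isomorphism given by a bijection. -/
def isoOfEquiv {X Y : CospanUHGraph.{u}} (f : X.carrier ≃ Y.carrier) : X ≅ Y where
  hom := mk (ofFun f)
  inv := mk (ofFun f.symm)
  hom_inv_id := Quotient.sound (Setoid.trans (ofFun_comp _ _) (by
    have : (f.symm ∘ f : X.carrier → X.carrier) = id := by ext; simp
    simp only [ofFun, this]; exact Setoid.refl _))
  inv_hom_id := Quotient.sound (Setoid.trans (ofFun_comp _ _) (by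
    have : (f ∘ f.symm : Y.carrier → Y.carrier) = id := by ext; simp
    simp only [ofFun, this]; exact Setoid.refl _))

instance : MonoidalCategoryStruct CospanUHGraph.{u} where
  tensorObj X Y := of (X.carrier ⊕ Y.carrier)
  tensorUnit := of PEmpty
  tensorHom := Quotient.map₂ tensor fun _ _ h _ _ h' => tensor_congr h h'
  whiskerLeft X _ _ f :=
    Quotient.map₂ tensor (fun _ _ h _ _ h' => tensor_congr h h') (𝟙 X) f
  whiskerRight f Y :=
    Quotient.map₂ tensor (fun _ _ h _ _ h' => tensor_congr h h') f (𝟙 Y)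
  associator _ _ _ := isoOfEquiv (Equiv.sumAssoc _ _ _)
  leftUnitor _ := isoOfEquiv (Equiv.emptySum PEmpty _)
  rightUnitor _ := isoOfEquiv (Equiv.sumEmpty _ PEmpty)

theorem ofFun_comp_ofFun {X Y Z : CospanUHGraph.{u}} (f : X.carrier → Y.carrier)
    (f' : Y.carrier → Z.carrier) :
    (mk (ofFun f) : X ⟶ Y) ≫ (mk (ofFun f') : Y ⟶ Z) = mk (ofFun (f' ∘ f)) :=
  Quotient.sound (ofFun_comp f (ofFun f'))

theorem ofFun_tensor_ofFun {X Y X' Y' : CospanUHGraph.{u}} (f : X.carrier → Y.carrier)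
    (f' : X'.carrier → Y'.carrier) :
    (mk (ofFun f) : X ⟶ Y) ⊗ₘ (mk (ofFun f') : X' ⟶ Y') =
      (mk (ofFun (Sum.map f f') : OpenUHGraph (X ⊗ X').carrier (Y ⊗ Y').carrier)) :=
  Quotient.sound (tensor_ofFun f f')

/-- The monoidal product is the component-wise coproduct. -/
instance : MonoidalCategory CospanUHGraph.{u} :=
  .ofTensorHom
    (id_tensorHom_id := fun X Y => (ofFun_tensor_ofFun id id).trans (by
      rw [Sum.map_id_id]; rfl))
    (id_tensorHom := fun _ _ _ _ => rfl)
    (tensorHom_id := fun _ _ => rfl)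
    (tensorHom_comp_tensorHom := by
      rintro _ _ _ _ _ _ ⟨g⟩ ⟨g'⟩ ⟨h⟩ ⟨h'⟩; exact Quotient.sound (tensor_comp g h g' h'))
    (associator_naturality := by
      rintro _ _ _ _ _ _ ⟨f⟩ ⟨g⟩ ⟨h⟩
      refine Quotient.sound (Setoid.trans (comp_ofFun _ (Equiv.sumAssoc _ _ _))
        (Setoid.trans ?_ (Setoid.symm (ofFun_comp _ _))))
      refine ⟨Equiv.sumAssoc _ _ _, Equiv.sumAssoc _ _ _, ?_, ?_, ?_⟩
      · rintro ((e | e) | e)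
        · change _ '' f.apex.ends e = _ '' (_ '' (_ '' f.apex.ends e))
          rw [Set.image_image, Set.image_image]; rfl
        · change _ '' (_ '' g.apex.ends e) = _ '' (_ '' (_ '' g.apex.ends e))
          rw [Set.image_image, Set.image_image, Set.image_image]; rfl
        · change _ '' (_ '' h.apex.ends e) = _ '' (_ '' h.apex.ends e)
          rw [Set.image_image, Set.image_image]; rfl
      · rintro ((e | e) | e) <;> rfl
      · rintro (e | e | e) <;> rfl)
    (leftUnitor_naturality := by
      rintro _ _ ⟨g⟩
      refine Quotient.sound (Setoid.trans (comp_ofFun _ (Equiv.emptySum PEmpty _))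
        (Setoid.trans ?_ (Setoid.symm (ofFun_comp _ _))))
      refine ⟨Equiv.emptySum PEmpty _, Equiv.emptySum PEmpty _, ?_, ?_, ?_⟩
      · rintro (e | e)
        · exact e.elim
        · change g.apex.ends e = _ '' (_ '' g.apex.ends e)
          rw [Set.image_image]; exact (Set.image_id _).symm
      · rintro (e | e)
        · exact e.elim
        · rfl
      · intro e; rfl)
    (rightUnitor_naturality := by
      rintro _ _ ⟨g⟩
      refine Quotient.sound (Setoid.trans (comp_ofFun _ (Equiv.sumEmpty _ PEmpty))
        (Setoid.trans ?_ (Setoid.symm (ofFun_comp _ _))))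
      refine ⟨Equiv.sumEmpty _ PEmpty, Equiv.sumEmpty _ PEmpty, ?_, ?_, ?_⟩
      · rintro (e | e)
        · change g.apex.ends e = _ '' (_ '' g.apex.ends e)
          rw [Set.image_image]; exact (Set.image_id _).symm
        · exact e.elim
      · rintro (e | e)
        · rfl
        · exact e.elim
      · intro e; rfl)
    (pentagon := by
      intro W X Y Z
      change ((mk (ofFun (Equiv.sumAssoc _ _ _)) : (W ⊗ X) ⊗ Y ⟶ W ⊗ X ⊗ Y) ⊗ₘ
          (mk (ofFun id) : Z ⟶ Z)) ≫
          (mk (ofFun (Equiv.sumAssoc _ _ _)) : (W ⊗ X ⊗ Y) ⊗ Z ⟶ W ⊗ (X ⊗ Y) ⊗ Z) ≫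
          ((mk (ofFun id) : W ⟶ W) ⊗ₘ
            (mk (ofFun (Equiv.sumAssoc _ _ _)) : (X ⊗ Y) ⊗ Z ⟶ X ⊗ Y ⊗ Z)) =
        (mk (ofFun (Equiv.sumAssoc _ _ _)) : ((W ⊗ X) ⊗ Y) ⊗ Z ⟶ (W ⊗ X) ⊗ Y ⊗ Z) ≫
          (mk (ofFun (Equiv.sumAssoc _ _ _)) : (W ⊗ X) ⊗ Y ⊗ Z ⟶ W ⊗ X ⊗ Y ⊗ Z)
      simp only [ofFun_tensor_ofFun, ofFun_comp_ofFun]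
      congr 2
      funext p
      rcases p with ((p | p) | p) | p <;> rfl)
    (triangle := by
      intro X Y
      change (mk (ofFun (Equiv.sumAssoc _ _ _)) : (X ⊗ 𝟙_ _) ⊗ Y ⟶ X ⊗ 𝟙_ _ ⊗ Y) ≫
          ((mk (ofFun id) : X ⟶ X) ⊗ₘ
            (mk (ofFun (Equiv.emptySum PEmpty _)) : 𝟙_ _ ⊗ Y ⟶ Y)) =
        (mk (ofFun (Equiv.sumEmpty _ PEmpty)) : X ⊗ 𝟙_ _ ⟶ X) ⊗ₘ (mk (ofFun id) : Y ⟶ Y)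
      simp only [ofFun_tensor_ofFun, ofFun_comp_ofFun]
      congr 2
      funext p
      rcases p with (p | p) | p
      · rfl
      · exact p.elim
      · rfl)

/-- The weight function on cospans of hypergraphs, where all morphisms are atoms: an object weighs
its cardinality and a morphism weighs the number of vertices of its apex. -/
noncomputable def weight : WeightFunction (⊤ : MorphismProperty CospanUHGraph.{u}) where
  obj X := Nat.card X.carrier
  atom g _ := Quotient.lift (fun g => Nat.card g.apex.V)
    (by rintro g h ⟨a, -⟩; exact Nat.card_congr a) g
  obj_tensor X Y := Nat.card_sum

instance {X Y : CospanUHGraph.{u}} (g : X ⟶ Y) :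
    Nonempty (MonoidalDecomposition (⊤ : MorphismProperty CospanUHGraph.{u}) g) :=
  ⟨.leaf g trivial⟩

end CospanUHGraph

/-- A hypergraph, as a cospan between empty boundaries. -/
def UHGraph.toCospan (G : UHGraph.{u}) : 𝟙_ CospanUHGraph.{u} ⟶ 𝟙_ CospanUHGraph.{u} :=
  CospanUHGraph.mk ⟨G, PEmpty.elim, PEmpty.elim⟩

/-!
Both inequalities come from translating one kind of decomposition into the other.

From a monoidal decomposition of width `w` to a tree decomposition of width at most `3 * w`: if the
boundaries of a morphism have at most `w` elements, then so do those of all subterms of the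
decomposition, because the boundaries of the factors of a monoidal product are parts of those of
the product, and a composition node pays for the object it composes along. By induction, the
hypergraph of every subterm has a tree decomposition with a root bag that contains both boundaries:
a leaf gets a single bag, and at an internal node a new root, whose bag consists of the images of
the boundaries of the two factors, is joined to the two old roots
(`UHGraph.exists_treeDecomposition_of_cover`). For a composite these are three objects, whence the
factor three (`OpenUHGraph.HasRootedTreeDecomposition.comp`).

From a tree decomposition of width `k` to a monoidal decomposition of width at most `k`: let `B` be
the bag at a root. The hypergraph, seen as an endomorphism `B → G ← B`, is decomposed
recursively. If the tree is cut at an edge from the root to a node with bag `B'`, then `G` is the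
union of two subhypergraphs `H ⊇ B` and `H' ⊇ B'` with `H ∩ H' ⊆ B ∩ B'`. Restricting the legs of
`B' → H' ← B'` to `B ∩ B'` and taking the monoidal product with the identity of `B \ B'` turns it
into an endomorphism of `B`, whose composite with `B → H ← B` is `B → G ← B`
(`UHGraph.SubHasMonoidalWidth.union`). All leaves and all objects composed along have at most `k`
elements. The point of using endomorphisms of the bag is that subtrees at the same node are attached
one after the other by compositions along `B`, so no two copies of a bag are needed at once. This
gives the monoidal width at most `k`, which implies both upper bounds.
-/

/-! ### Trees with bags -/

namespace SimpleGraph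

variable {Y Y₁ Y₂ V V' : Type*}

/-- Two finite trees joined by an edge form a tree. -/
theorem IsTree.sum_sup_edge [Finite Y₁] [Finite Y₂] {T₁ : SimpleGraph Y₁} {T₂ : SimpleGraph Y₂}
    (h₁ : T₁.IsTree) (h₂ : T₂.IsTree) (a : Y₁) (b : Y₂) :
    ((T₁ ⊕g T₂) ⊔ edge (.inl a) (.inr b)).IsTree := by
  have hc := h₁.connected.sum_sup_edge h₂.connected (v := a) (w := b)
  refine isTree_iff_connected_and_card.2 ⟨hc, le_antisymm ?_ hc.card_vert_le_card_edgeSet_add_one⟩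
  have e₁ := (isTree_iff_connected_and_card.1 h₁).2
  have e₂ := (isTree_iff_connected_and_card.1 h₂).2
  have e₃ : Nat.card (T₁ ⊕g T₂).edgeSet = _ :=
    (Nat.card_congr edgeSetSumEquiv).trans Nat.card_sum
  have e₄ : ((T₁ ⊕g T₂) ⊔ edge (.inl a) (.inr b)).edgeSet.ncard ≤ (T₁ ⊕g T₂).edgeSet.ncard + 1 := by
    rw [edgeSet_sup]
    refine (Set.ncard_union_le _ _).trans (Nat.add_le_add_left ?_ _)
    rw [edge, edgeSet_fromEdgeSet]
    exact (Set.ncard_le_ncard Set.sdiff_subset).trans (Set.ncard_singleton _).le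
  rw [Nat.card_coe_set_eq] at e₃ ⊢
  rw [Nat.card_sum]
  omega

/-- The running intersection property in terms of walks: any two nodes whose bags contain a vertex
are linked by a walk through bags that contain it. -/
def RunningIntersection (T : SimpleGraph Y) (bag : Y → Set V) : Prop :=
  ∀ v i k, v ∈ bag i → v ∈ bag k → ∃ p : T.Walk i k, ∀ j ∈ p.support, v ∈ bag j

/-- In an acyclic graph, a walk visits all nodes of the path between its ends. -/
theorem IsAcyclic.support_subset_support {T : SimpleGraph Y} (hT : T.IsAcyclic) {i k : Y}
    {p : T.Walk i k} (hp : p.IsPath) (q : T.Walk i k) : p.support ⊆ q.support := by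
  classical
  obtain rfl : p = q.bypass :=
    congrArg Subtype.val ((hT.subsingleton_path i k).elim ⟨p, hp⟩ ⟨q.bypass, q.bypass_isPath⟩)
  exact q.support_bypass_subset_support

/-- The running intersection property passes to images under a map that identifies vertices only
if they are in the bag at some fixed node `r`: a walk can be rerouted through `r`. -/
theorem RunningIntersection.image {T : SimpleGraph Y} {bag : Y → Set V}
    (h : T.RunningIntersection bag) (φ : V → V') (r : Y)
    (hφ : ∀ x x', φ x = φ x' → x = x' ∨ x ∈ bag r ∧ x' ∈ bag r) :
    T.RunningIntersection fun i => φ '' bag i := by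
  rintro _ i k ⟨x, hx, rfl⟩ ⟨x', hx', hxx'⟩
  rcases hφ _ _ hxx' with rfl | ⟨hr', hr⟩
  · obtain ⟨p, hp⟩ := h _ i k hx hx'
    exact ⟨p, fun j hj => ⟨_, hp j hj, rfl⟩⟩
  · obtain ⟨p, hp⟩ := h _ i r hx hr
    obtain ⟨q, hq⟩ := h _ r k hr' hx'
    refine ⟨p.append q, fun j hj => ?_⟩
    rcases (Walk.mem_support_append_iff _ _).1 hj with hj | hj
    · exact ⟨_, hp j hj, rfl⟩
    · exact ⟨_, hq j hj, hxx'⟩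

theorem RunningIntersection.exists_walk_map {T₁ : SimpleGraph Y₁} {T₂ : SimpleGraph Y₂}
    {bag₁ : Y₁ → Set V} {bag₂ : Y₂ → Set V} (h : T₁.RunningIntersection bag₁) (f : T₁ →g T₂)
    (hf : ∀ i, bag₁ i ⊆ bag₂ (f i)) (v : V) (i k : Y₁) (hi : v ∈ bag₁ i) (hk : v ∈ bag₁ k) :
    ∃ p : T₂.Walk (f i) (f k), ∀ j ∈ p.support, v ∈ bag₂ j := by
  obtain ⟨p, hp⟩ := h v i k hi hk
  refine ⟨p.map f, fun j hj => ?_⟩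
  rw [Walk.support_map, List.mem_map] at hj
  obtain ⟨j, hj, rfl⟩ := hj
  exact hf j (hp j hj)

theorem RunningIntersection.sum_sup_edge {T₁ : SimpleGraph Y₁} {T₂ : SimpleGraph Y₂}
    {bag₁ : Y₁ → Set V} {bag₂ : Y₂ → Set V} (h₁ : T₁.RunningIntersection bag₁)
    (h₂ : T₂.RunningIntersection bag₂) (a : Y₁) (b : Y₂)
    (h : ∀ v i k, v ∈ bag₁ i → v ∈ bag₂ k → v ∈ bag₁ a ∧ v ∈ bag₂ b) :
    ((T₁ ⊕g T₂) ⊔ edge (.inl a) (.inr b)).RunningIntersection (Sum.elim bag₁ bag₂) := by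
  set T := (T₁ ⊕g T₂) ⊔ edge (.inl a) (.inr b)
  let f₁ : T₁ →g T := (Hom.ofLE (le_sup_left : T₁ ⊕g T₂ ≤ T)).comp Embedding.sumInl.toHom
  let f₂ : T₂ →g T := (Hom.ofLE (le_sup_left : T₁ ⊕g T₂ ≤ T)).comp Embedding.sumInr.toHom
  have inl : ∀ v i k, v ∈ bag₁ i → v ∈ bag₁ k →
      ∃ p : T.Walk (.inl i) (.inl k), ∀ j ∈ p.support, v ∈ Sum.elim bag₁ bag₂ j :=
    h₁.exists_walk_map f₁ fun _ _ hv => hv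
  have inr : ∀ v i k, v ∈ bag₂ i → v ∈ bag₂ k →
      ∃ p : T.Walk (.inr i) (.inr k), ∀ j ∈ p.support, v ∈ Sum.elim bag₁ bag₂ j :=
    h₂.exists_walk_map f₂ fun _ _ hv => hv
  have hab : T.Adj (.inl a) (.inr b) := by simp [T, edge_adj]
  have cross : ∀ v i k, v ∈ bag₁ i → v ∈ bag₂ k →
      ∃ p : T.Walk (.inl i) (.inr k), ∀ j ∈ p.support, v ∈ Sum.elim bag₁ bag₂ j := by
    intro v i k hi hk
    obtain ⟨ha, hb⟩ := h v i k hi hk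
    obtain ⟨p, hp⟩ := inl v i a hi ha
    obtain ⟨q, hq⟩ := inr v b k hb hk
    refine ⟨p.append (.cons hab q), fun j hj => ?_⟩
    rw [Walk.mem_support_append_iff, Walk.support_cons, List.mem_cons] at hj
    rcases hj with hj | rfl | hj
    exacts [hp j hj, ha, hq j hj]
  rintro v (i | i) (k | k) hi hk
  · exact inl v i k hi hk
  · exact cross v i k hi hk
  · obtain ⟨p, hp⟩ := cross v k i hk hi
    exact ⟨p.reverse, fun j hj => hp j (by simpa using hj)⟩
  · exact inr v i k hi hk

end SimpleGraph

namespace UHGraph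

/-- A tree decomposition from a tree with the running intersection property for walks. -/
def TreeDecomposition.ofRunningIntersection {G : UHGraph.{u}} {Y : Type} [Finite Y]
    {T : SimpleGraph Y} (hT : T.IsTree) {bag : Y → Set G.V} (h : T.RunningIntersection bag)
    (hv : ∀ x, ∃ i, x ∈ bag i) (he : ∀ e, ∃ i, G.ends e ⊆ bag i) : TreeDecomposition G where
  Y := Y
  tree := T
  isTree := hT
  bag := bag
  exists_mem_bag := hv
  exists_ends_subset_bag := he
  inter_subset_bag i k p hp j hj v hv := by
    obtain ⟨q, hq⟩ := h v i k hv.1 hv.2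
    exact hq j (hT.isAcyclic.support_subset_support hp q hj)

theorem TreeDecomposition.runningIntersection {G : UHGraph.{u}} (T : TreeDecomposition G) :
    T.tree.RunningIntersection T.bag := by
  intro v i k hi hk
  obtain ⟨p, hp⟩ := (T.isTree.existsUnique_path i k).exists
  exact ⟨p, fun j hj => T.inter_subset_bag i k p hp j hj ⟨hi, hk⟩⟩

/-- If `G` is covered by two hypergraphs that overlap, and fail to be embedded, only in a set `R`
of vertices, then tree decompositions of the two, with nodes whose bags contain the preimages of
`R`, combine to a tree decomposition of `G` with an additional bag `R`. -/
theorem exists_treeDecomposition_of_cover {G G₁ G₂ : UHGraph.{u}}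
    (T₁ : TreeDecomposition G₁) (r₁ : T₁.Y) (T₂ : TreeDecomposition G₂) (r₂ : T₂.Y)
    (φ₁ : G₁.V → G.V) (φ₂ : G₂.V → G.V) (R : Set G.V)
    (hv : ∀ v, (∃ x, φ₁ x = v) ∨ ∃ x, φ₂ x = v)
    (he : ∀ e, (∃ e', G.ends e = φ₁ '' G₁.ends e') ∨ ∃ e', G.ends e = φ₂ '' G₂.ends e')
    (hφ₁ : ∀ x x', φ₁ x = φ₁ x' → x = x' ∨ φ₁ x ∈ R)
    (hφ₂ : ∀ x x', φ₂ x = φ₂ x' → x = x' ∨ φ₂ x ∈ R)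
    (hφ : ∀ x x', φ₁ x = φ₂ x' → φ₁ x ∈ R)
    (hR₁ : ∀ x, φ₁ x ∈ R → x ∈ T₁.bag r₁) (hR₂ : ∀ x, φ₂ x ∈ R → x ∈ T₂.bag r₂) :
    ∃ (T : TreeDecomposition G) (r : T.Y), T.bag r = R ∧
      ∀ i, T.bag i = R ∨ (∃ j, T.bag i = φ₁ '' T₁.bag j) ∨ ∃ j, T.bag i = φ₂ '' T₂.bag j := by
  have I₁ := T₁.runningIntersection.image φ₁ r₁ fun x x' h =>
    (hφ₁ x x' h).imp_right fun hR => ⟨hR₁ _ hR, hR₁ _ (h ▸ hR)⟩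
  have I₂ := T₂.runningIntersection.image φ₂ r₂ fun x x' h =>
    (hφ₂ x x' h).imp_right fun hR => ⟨hR₂ _ hR, hR₂ _ (h ▸ hR)⟩
  have I₀ : (⊥ : SimpleGraph Unit).RunningIntersection fun _ => R :=
    fun v i k hi _ => ⟨.nil, fun _ _ => hi⟩
  have J := I₀.sum_sup_edge I₁ () r₁ (by
    rintro _ - k hR ⟨x, hx, rfl⟩; exact ⟨hR, x, hR₁ x hR, rfl⟩)
  have K := J.sum_sup_edge I₂ (.inl ()) r₂ (by
    rintro _ (i | i) k hi ⟨x, hx, rfl⟩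
    · exact ⟨hi, x, hR₂ x hi, rfl⟩
    · obtain ⟨y, hy, hyx⟩ := hi
      have := hφ _ _ hyx
      rw [hyx] at this
      exact ⟨this, x, hR₂ x this, rfl⟩)
  refine ⟨.ofRunningIntersection
    (((SimpleGraph.IsTree.of_subsingleton.sum_sup_edge T₁.isTree () r₁).sum_sup_edge
      T₂.isTree (.inl ()) r₂)) K ?_ ?_, .inl (.inl ()), rfl, ?_⟩
  · intro v
    rcases hv v with ⟨x, rfl⟩ | ⟨x, rfl⟩
    · obtain ⟨i, hi⟩ := T₁.exists_mem_bag x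
      exact ⟨.inl (.inr i), x, hi, rfl⟩
    · obtain ⟨i, hi⟩ := T₂.exists_mem_bag x
      exact ⟨.inr i, x, hi, rfl⟩
  · intro e
    rcases he e with ⟨e', h⟩ | ⟨e', h⟩
    · obtain ⟨i, hi⟩ := T₁.exists_ends_subset_bag e'
      exact ⟨.inl (.inr i), h ▸ Set.image_mono hi⟩
    · obtain ⟨i, hi⟩ := T₂.exists_ends_subset_bag e'
      exact ⟨.inr i, h ▸ Set.image_mono hi⟩
  · rintro ((i | i) | i)
    exacts [.inl rfl, .inr (.inl ⟨i, rfl⟩), .inr (.inr ⟨i, rfl⟩)]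

theorem treeWidth_le {G : UHGraph.{u}} {n : ℕ} (T : TreeDecomposition G)
    (h : ∀ i, (T.bag i).ncard ≤ n) : G.treeWidth ≤ n :=
  (ciInf_le' _ T).trans (ciSup_le' h)

/-- The tree width is attained. -/
theorem exists_treeDecomposition (G : UHGraph.{u}) :
    ∃ T : TreeDecomposition G, ∀ i, (T.bag i).ncard ≤ G.treeWidth := by
  obtain ⟨T, hT⟩ := ciInf_mem fun T : TreeDecomposition G => T.width
  refine ⟨T, fun i => ?_⟩
  rw [treeWidth, ← hT]
  exact le_ciSup (Set.finite_range fun i => (T.bag i).ncard).bddAbove i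

end UHGraph

/-! ### Tree decompositions from monoidal decompositions -/

theorem Set.ncard_range_le_natCard {α β : Type*} [Finite α] (f : α → β) :
    (Set.range f).ncard ≤ Nat.card α := by
  rw [← Nat.card_coe_set_eq]
  exact Finite.card_range_le f

namespace OpenUHGraph

variable {X Y Z X' Y' : Type u}

/-- The apex of a cospan has a tree decomposition of width at most `n` with a bag that contains
the images of both boundaries. -/
def HasRootedTreeDecomposition (n : ℕ) (g : OpenUHGraph X Y) : Prop :=
  ∃ (T : UHGraph.TreeDecomposition g.apex) (r : T.Y), (∀ i, (T.bag i).ncard ≤ n) ∧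
    Set.range g.left ⊆ T.bag r ∧ Set.range g.right ⊆ T.bag r

/-- Two vertices are identified by gluing only if they are equal or both on the common boundary. -/
theorem eq_or_of_quot_mk_eq (g : OpenUHGraph X Y) (h : OpenUHGraph Y Z) {p q : g.apex.V ⊕ h.apex.V}
    (hpq : Quot.mk (glueRel g h) p = Quot.mk _ q) :
    p = q ∨ (p ∈ Set.range (.inl ∘ g.right) ∪ Set.range (.inr ∘ h.left)) ∧
      q ∈ Set.range (.inl ∘ g.right) ∪ Set.range (.inr ∘ h.left) := by
  induction Quot.eqvGen_exact hpq with
  | rel p q h =>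
    obtain ⟨y, rfl, rfl⟩ := h
    exact .inr ⟨.inl ⟨y, rfl⟩, .inr ⟨y, rfl⟩⟩
  | refl p => exact .inl rfl
  | symm p q h ih => exact (ih (Quot.eqvGen_sound h)).imp Eq.symm And.symm
  | trans p q r h h' ih ih' =>
    rcases ih (Quot.eqvGen_sound h) with rfl | ⟨h₁, h₂⟩
    · exact ih' (Quot.eqvGen_sound h')
    · rcases ih' (Quot.eqvGen_sound h') with rfl | ⟨h₃, h₄⟩
      exacts [.inr ⟨h₁, h₂⟩, .inr ⟨h₁, h₄⟩]

/-- The new bag consists of the three boundaries of the factors. -/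
theorem HasRootedTreeDecomposition.comp [Finite X] [Finite Y] [Finite Z] {w : ℕ}
    {g : OpenUHGraph X Y} {h : OpenUHGraph Y Z} (hX : Nat.card X ≤ w) (hY : Nat.card Y ≤ w)
    (hZ : Nat.card Z ≤ w) (hg : g.HasRootedTreeDecomposition (3 * w))
    (hh : h.HasRootedTreeDecomposition (3 * w)) :
    (g.comp h).HasRootedTreeDecomposition (3 * w) := by
  obtain ⟨T₁, r₁, hT₁, hl₁, hr₁⟩ := hg
  obtain ⟨T₂, r₂, hT₂, hl₂, hr₂⟩ := hh
  have bd : ∀ y, Quot.mk (glueRel g h) (.inl (g.right y)) = Quot.mk _ (.inr (h.left y)) :=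
    glue_sound g h
  obtain ⟨T, r, hr, hT⟩ := UHGraph.exists_treeDecomposition_of_cover (G := (g.comp h).apex)
    T₁ r₁ T₂ r₂ (fun p => Quot.mk _ (.inl p)) (fun p => Quot.mk _ (.inr p))
    (Set.range (g.comp h).left ∪ Set.range (g.comp h).right ∪
      Set.range fun y => Quot.mk _ (.inl (g.right y)))
    (by rintro ⟨p | p⟩; exacts [.inl ⟨p, rfl⟩, .inr ⟨p, rfl⟩])
    (by rintro (e | e); exacts [.inl ⟨e, rfl⟩, .inr ⟨e, rfl⟩])
    (by
      intro x x' hx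
      rcases eq_or_of_quot_mk_eq g h hx with hx | ⟨⟨y, hy⟩ | ⟨y, hy⟩, -⟩
      · exact .inl (Sum.inl_injective hx)
      · exact .inr (.inr ⟨y, congrArg (Quot.mk _) hy⟩)
      · simp at hy)
    (by
      intro x x' hx
      rcases eq_or_of_quot_mk_eq g h hx with hx | ⟨⟨y, hy⟩ | ⟨y, hy⟩, -⟩
      · exact .inl (Sum.inr_injective hx)
      · simp at hy
      · exact .inr (.inr ⟨y, (bd y).trans (congrArg (Quot.mk _) hy)⟩))
    (by
      intro x x' hx
      rcases eq_or_of_quot_mk_eq g h hx with hx | ⟨⟨y, hy⟩ | ⟨y, hy⟩, -⟩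
      · simp at hx
      · exact .inr ⟨y, congrArg (Quot.mk _) hy⟩
      · simp at hy)
    (by
      rintro x ((⟨y, hy⟩ | ⟨y, hy⟩) | ⟨y, hy⟩) <;>
        rcases eq_or_of_quot_mk_eq g h hy with hx | ⟨-, ⟨z, hz⟩ | ⟨z, hz⟩⟩
      · exact hl₁ ⟨y, Sum.inl_injective hx⟩
      · exact hr₁ ⟨z, Sum.inl_injective hz⟩
      · simp at hz
      · simp at hx
      · exact hr₁ ⟨z, Sum.inl_injective hz⟩
      · simp at hz
      · exact hr₁ ⟨y, Sum.inl_injective hx⟩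
      · exact hr₁ ⟨z, Sum.inl_injective hz⟩
      · simp at hz)
    (by
      rintro x ((⟨y, hy⟩ | ⟨y, hy⟩) | ⟨y, hy⟩) <;>
        rcases eq_or_of_quot_mk_eq g h hy with hx | ⟨-, ⟨z, hz⟩ | ⟨z, hz⟩⟩
      · simp at hx
      · simp at hz
      · exact hl₂ ⟨z, Sum.inr_injective hz⟩
      · exact hr₂ ⟨y, Sum.inr_injective hx⟩
      · simp at hz
      · exact hl₂ ⟨z, Sum.inr_injective hz⟩
      · simp at hx
      · simp at hz
      · exact hl₂ ⟨z, Sum.inr_injective hz⟩)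
  refine ⟨T, r, fun i => ?_, ?_, ?_⟩
  · rcases hT i with h' | ⟨j, h'⟩ | ⟨j, h'⟩ <;> rw [h']
    · refine (Set.ncard_union_le _ _).trans ?_
      have h₀ := Set.ncard_union_le (Set.range (g.comp h).left) (Set.range (g.comp h).right)
      have h₁ := Set.ncard_range_le_natCard (g.comp h).left
      have h₂ := Set.ncard_range_le_natCard (g.comp h).right
      have h₃ := Set.ncard_range_le_natCard fun y => Quot.mk (glueRel g h) (.inl (g.right y))
      omega
    · exact (Set.ncard_image_le (Set.toFinite _)).trans (hT₁ j)
    · exact (Set.ncard_image_le (Set.toFinite _)).trans (hT₂ j)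
  · exact hr ▸ fun x hx => .inl (.inl hx)
  · exact hr ▸ fun x hx => .inl (.inr hx)

theorem HasRootedTreeDecomposition.tensor [Finite X] [Finite Y] [Finite X'] [Finite Y'] {w : ℕ}
    {g : OpenUHGraph X Y} {h : OpenUHGraph X' Y'} (hX : Nat.card (X ⊕ X') ≤ w)
    (hY : Nat.card (Y ⊕ Y') ≤ w) (hg : g.HasRootedTreeDecomposition (3 * w))
    (hh : h.HasRootedTreeDecomposition (3 * w)) :
    (g.tensor h).HasRootedTreeDecomposition (3 * w) := by
  obtain ⟨T₁, r₁, hT₁, hl₁, hr₁⟩ := hg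
  obtain ⟨T₂, r₂, hT₂, hl₂, hr₂⟩ := hh
  obtain ⟨T, r, hr, hT⟩ := UHGraph.exists_treeDecomposition_of_cover (G := (g.tensor h).apex)
    T₁ r₁ T₂ r₂ .inl .inr (Set.range (g.tensor h).left ∪ Set.range (g.tensor h).right)
    (by rintro (p | p); exacts [.inl ⟨p, rfl⟩, .inr ⟨p, rfl⟩])
    (by rintro (e | e); exacts [.inl ⟨e, rfl⟩, .inr ⟨e, rfl⟩])
    (fun x x' hx => .inl (Sum.inl_injective hx))
    (fun x x' hx => .inl (Sum.inr_injective hx))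
    (fun x x' hx => by simp at hx)
    (by
      rintro x (⟨y | y, hy⟩ | ⟨y | y, hy⟩)
      exacts [hl₁ ⟨y, Sum.inl_injective hy⟩, by simp at hy, hr₁ ⟨y, Sum.inl_injective hy⟩,
        by simp at hy])
    (by
      rintro x (⟨y | y, hy⟩ | ⟨y | y, hy⟩)
      exacts [by simp at hy, hl₂ ⟨y, Sum.inr_injective hy⟩, by simp at hy,
        hr₂ ⟨y, Sum.inr_injective hy⟩])
  refine ⟨T, r, fun i => ?_, ?_, ?_⟩
  · rcases hT i with h' | ⟨j, h'⟩ | ⟨j, h'⟩ <;> rw [h']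
    · refine (Set.ncard_union_le _ _).trans ?_
      have h₁ := Set.ncard_range_le_natCard (g.tensor h).left
      have h₂ := Set.ncard_range_le_natCard (g.tensor h).right
      omega
    · exact (Set.ncard_image_le (Set.toFinite _)).trans (hT₁ j)
    · exact (Set.ncard_image_le (Set.toFinite _)).trans (hT₂ j)
  · exact hr ▸ Set.subset_union_left
  · exact hr ▸ Set.subset_union_right

end OpenUHGraph

namespace CospanUHGraph

/-- The bounds on the boundaries of `f` are passed on to all subterms of the decomposition: the
boundaries of the factors of a monoidal product are parts of those of the product, and the object
along which a composition is taken is paid for by the width. -/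
theorem exists_hasRootedTreeDecomposition {X Y : CospanUHGraph.{u}} {f : X ⟶ Y}
    (d : MonoidalDecomposition (⊤ : MorphismProperty CospanUHGraph.{u}) f) {w : ℕ}
    (hd : d.width weight ≤ w) (hX : Nat.card X.carrier ≤ w) (hY : Nat.card Y.carrier ≤ w) :
    ∃ g, mk g = f ∧ g.HasRootedTreeDecomposition (3 * w) := by
  induction d with
  | leaf f hf =>
    obtain ⟨g, rfl⟩ := Quotient.exists_rep f
    refine ⟨g, rfl, .ofRunningIntersection (Y := Unit) (T := ⊥) (bag := fun _ => Set.univ)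
      .of_subsingleton (fun _ _ _ _ _ => ⟨.nil, fun _ _ => trivial⟩) (fun _ => ⟨(), trivial⟩)
      (fun _ => ⟨(), Set.subset_univ _⟩), (), fun i => ?_, Set.subset_univ _, Set.subset_univ _⟩
    have : Nat.card g.apex.V ≤ w := hd
    exact (Set.ncard_univ _).trans_le (by omega)
  | @tensor X₁ Y₁ X₂ Y₂ f₁ f₂ d₁ d₂ ih₁ ih₂ =>
    have hX' : Nat.card (X₁.carrier ⊕ X₂.carrier) ≤ w := hX
    have hY' : Nat.card (Y₁.carrier ⊕ Y₂.carrier) ≤ w := hY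
    have hX'' := hX'
    have hY'' := hY'
    rw [Nat.card_sum] at hX'' hY''
    obtain ⟨g₁, rfl, h₁⟩ := ih₁ ((le_max_left _ _).trans hd) (by omega) (by omega)
    obtain ⟨g₂, rfl, h₂⟩ := ih₂ ((le_max_right _ _).trans hd) (by omega) (by omega)
    exact ⟨g₁.tensor g₂, rfl, h₁.tensor hX' hY' h₂⟩
  | @comp X Y Z f₁ f₂ d₁ d₂ ih₁ ih₂ =>
    obtain ⟨hd₁, hd'⟩ := max_le_iff.1 hd
    obtain ⟨hYw, hd₂⟩ := max_le_iff.1 hd'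
    obtain ⟨g₁, rfl, h₁⟩ := ih₁ hd₁ hX hYw
    obtain ⟨g₂, rfl, h₂⟩ := ih₂ hd₂ hYw hY
    exact ⟨g₁.comp g₂, rfl, h₁.comp hX hYw hY h₂⟩

end CospanUHGraph

theorem UHGraph.treeWidth_le_of_equiv {G H : UHGraph.{u}} (a : G.V ≃ H.V) (b : G.E ≃ H.E)
    (hab : ∀ e, H.ends (b e) = a '' G.ends e) {n : ℕ} (T : TreeDecomposition G)
    (hT : ∀ i, (T.bag i).ncard ≤ n) : H.treeWidth ≤ n := by
  obtain ⟨r⟩ := T.isTree.connected.nonempty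
  refine UHGraph.treeWidth_le (.ofRunningIntersection T.isTree
    (T.runningIntersection.image a r fun x x' h => .inl (a.injective h)) ?_ ?_)
    fun i => (Set.ncard_image_le (Set.toFinite _)).trans (hT i)
  · intro x
    obtain ⟨i, hi⟩ := T.exists_mem_bag (a.symm x)
    exact ⟨i, _, hi, a.apply_symm_apply x⟩
  · intro e
    obtain ⟨e, rfl⟩ := b.surjective e
    obtain ⟨i, hi⟩ := T.exists_ends_subset_bag e
    exact ⟨i, hab e ▸ Set.image_mono hi⟩

theorem UHGraph.treeWidth_le_three_mul_monoidalWidth (G : UHGraph.{u}) :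
    G.treeWidth ≤ 3 * monoidalWidth CospanUHGraph.weight G.toCospan := by
  obtain ⟨d, hd⟩ := ciInf_mem fun d : MonoidalDecomposition
    (⊤ : MorphismProperty CospanUHGraph.{u}) G.toCospan => d.width CospanUHGraph.weight
  have h₀ : Nat.card (𝟙_ CospanUHGraph.{u}).carrier = 0 := Nat.card_of_isEmpty (α := PEmpty)
  obtain ⟨g, hg, T, -, hT, -⟩ := CospanUHGraph.exists_hasRootedTreeDecomposition d le_rfl
    (h₀.trans_le (Nat.zero_le _)) (h₀.trans_le (Nat.zero_le _))
  obtain ⟨a, b, hab, -⟩ := Quotient.exact hg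
  rw [monoidalWidth, ← hd]
  exact treeWidth_le_of_equiv a b hab T hT

/-! ### Monoidal decompositions from tree decompositions -/

namespace OpenUHGraph

variable {X Y Z X' Y' : Type u}

/-- The morphism represented by a cospan has monoidal width at most `w`. -/
def HasMonoidalWidth [Finite X] [Finite Y] (w : ℕ) (g : OpenUHGraph X Y) : Prop :=
  ∃ d : MonoidalDecomposition (⊤ : MorphismProperty CospanUHGraph.{u})
    (CospanUHGraph.mk g : CospanUHGraph.of X ⟶ CospanUHGraph.of Y),
    d.width CospanUHGraph.weight ≤ w

namespace HasMonoidalWidth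

variable [Finite X] [Finite Y] [Finite Z] [Finite X'] [Finite Y'] {w : ℕ}

theorem leaf {g : OpenUHGraph X Y} (h : Nat.card g.apex.V ≤ w) : g.HasMonoidalWidth w :=
  ⟨.leaf _ trivial, h⟩

theorem congr {g h : OpenUHGraph X Y} (hg : g.HasMonoidalWidth w) (hgh : g ≈ h) :
    h.HasMonoidalWidth w := by
  obtain ⟨d, hd⟩ := hg
  have : (CospanUHGraph.mk g : CospanUHGraph.of X ⟶ CospanUHGraph.of Y) = CospanUHGraph.mk h :=
    Quotient.sound hgh
  rw [HasMonoidalWidth, ← this]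
  exact ⟨d, hd⟩

theorem comp {g : OpenUHGraph X Y} {h : OpenUHGraph Y Z} (hY : Nat.card Y ≤ w)
    (hg : g.HasMonoidalWidth w) (hh : h.HasMonoidalWidth w) : (g.comp h).HasMonoidalWidth w := by
  obtain ⟨d, hd⟩ := hg
  obtain ⟨e, he⟩ := hh
  exact ⟨.comp d e, max_le hd (max_le hY he)⟩

theorem tensor {g : OpenUHGraph X Y} {h : OpenUHGraph X' Y'} (hg : g.HasMonoidalWidth w)
    (hh : h.HasMonoidalWidth w) : (g.tensor h).HasMonoidalWidth w := by
  obtain ⟨d, hd⟩ := hg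
  obtain ⟨e, he⟩ := hh
  exact ⟨.tensor d e, max_le hd he⟩

/-- Changing the legs of a cospan along functions into its boundaries costs no more than the
boundaries. -/
theorem comp_legs {G : UHGraph.{u}} {l : X → G.V} {r : Y → G.V} (hX : Nat.card X ≤ w)
    (hY : Nat.card Y ≤ w) (h : HasMonoidalWidth w ⟨G, l, r⟩) (f : X' → X) (f' : Y' → Y) :
    HasMonoidalWidth w ⟨G, l ∘ f, r ∘ f'⟩ := by
  have h₁ : HasMonoidalWidth w ⟨G, l ∘ f, r⟩ :=
    (comp hX (leaf (g := ofFun f) hX) h).congr (ofFun_comp f _)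
  refine (comp hY h₁ (leaf (g := ⟨.discrete Y, id, f'⟩) hY)).congr ?_
  refine ⟨⟨Quot.lift (Sum.elim id r) ?_, fun p => Quot.mk _ (.inl p), ?_, fun _ => rfl⟩,
    ⟨Sum.elim id PEmpty.elim, .inl, ?_, fun _ => rfl⟩, ?_, fun _ => rfl, fun _ => rfl⟩
  · rintro _ _ ⟨y, rfl, rfl⟩; rfl
  · rintro ⟨p | p⟩
    · rfl
    · exact glue_sound ⟨G, l ∘ f, r⟩ ⟨.discrete Y, id, f'⟩ p
  · rintro (e | e)
    · rfl
    · exact e.elim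
  · rintro (e | e)
    · change G.ends e = _ '' ((fun p => Quot.mk _ (Sum.inl p)) '' G.ends e)
      rw [Set.image_image]
      exact (Set.image_id _).symm
    · exact e.elim

end HasMonoidalWidth

end OpenUHGraph

namespace UHGraph

open OpenUHGraph

variable {G : UHGraph.{u}}

/-- The subhypergraph of `G` with vertices `A` and edges `F`, as a cospan `B → (A, F) ← B` for a
set `B` of its vertices, has monoidal width at most `w`. The subhypergraph is given by some
hypergraph with injections into `G`. -/
def SubHasMonoidalWidth (w : ℕ) (B A : Set G.V) (F : Set G.E) : Prop :=
  ∃ (H : UHGraph.{u}) (l : B → H.V) (a : H.V → G.V) (b : H.E → G.E),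
    HasMonoidalWidth w ⟨H, l, l⟩ ∧ a.Injective ∧ b.Injective ∧ Set.range a = A ∧ Set.range b = F ∧
    (∀ e, G.ends (b e) = a '' H.ends e) ∧ ∀ x, a (l x) = x

theorem SubHasMonoidalWidth.single {w : ℕ} {B : Set G.V} (hB : B.ncard ≤ w) {F : Set G.E}
    (hF : ∀ e ∈ F, G.ends e ⊆ B) : SubHasMonoidalWidth w B B F := by
  refine ⟨⟨B, F, fun e => Subtype.val ⁻¹' G.ends e⟩, id, Subtype.val, Subtype.val,
    .leaf ((Nat.card_coe_set_eq B).trans_le hB), Subtype.val_injective, Subtype.val_injective,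
    Subtype.range_val, Subtype.range_val, fun e => ?_, fun _ => rfl⟩
  exact (Set.image_preimage_eq_of_subset (by simpa using hF e e.2)).symm

/-- Gluing two subhypergraphs that overlap only in `B ∩ B'`. The second one is seen as an
endomorphism of `B` by restricting its legs to `B ∩ B'` and taking the monoidal product with the
identity of `B \ B'`; the two endomorphisms of `B` are then composed. No object heavier than `B`
or `B'` appears. -/
theorem SubHasMonoidalWidth.union {w : ℕ} {B A B' A' : Set G.V} {F F' : Set G.E}
    (hB : B.ncard ≤ w) (hB' : B'.ncard ≤ w) (h : SubHasMonoidalWidth w B A F)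
    (h' : SubHasMonoidalWidth w B' A' F') (hA : A ∩ A' ⊆ B ∩ B') (hF : Disjoint F F') :
    SubHasMonoidalWidth w B (A ∪ A') (F ∪ F') := by
  classical
  obtain ⟨H, l, a, b, hH, ha, hb, rfl, rfl, hab, hal⟩ := h
  obtain ⟨H', l', a', b', hH', ha', hb', rfl, rfl, hab', hal'⟩ := h'
  have hBw : Nat.card B ≤ w := (Nat.card_coe_set_eq B).trans_le hB
  have hBw' : Nat.card B' ≤ w := (Nat.card_coe_set_eq B').trans_le hB'
  let s : B → (B ∩ B' : Set G.V) ⊕ (B \ B' : Set G.V) := fun x =>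
    if hx : (x : G.V) ∈ B' then .inl ⟨x, x.2, hx⟩ else .inr ⟨x, x.2, hx⟩
  have hs : Nat.card ((B ∩ B' : Set G.V) ⊕ (B \ B' : Set G.V) : Type u) ≤ w := by
    rw [Nat.card_sum, Nat.card_coe_set_eq, Nat.card_coe_set_eq,
      Set.ncard_inter_add_ncard_sdiff_eq_ncard]
    exact hB
  have hid : HasMonoidalWidth w (ofFun (id : (B \ B' : Set G.V) → (B \ B' : Set G.V))) :=
    .leaf ((Nat.card_coe_set_eq _).trans_le ((Set.ncard_le_ncard Set.sdiff_subset).trans hB))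
  let ι : (B ∩ B' : Set G.V) → B' := Set.inclusion Set.inter_subset_right
  let m : OpenUHGraph (B ∩ B' : Set G.V) (B ∩ B' : Set G.V) := ⟨H', l' ∘ ι, l' ∘ ι⟩
  let g : OpenUHGraph B B := ⟨H, l, l⟩
  let k : OpenUHGraph B B := ⟨(m.tensor (ofFun id)).apex, (m.tensor (ofFun id)).left ∘ s,
    (m.tensor (ofFun id)).right ∘ s⟩
  have hk : k.HasMonoidalWidth w :=
    ((hH'.comp_legs hBw' hBw' ι ι).tensor hid).comp_legs hs hs s s
  -- The vertex of the second factor that lies over a vertex of `B`.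
  have k_left : ∀ x : B, (∃ hx : (x : G.V) ∈ B', k.left x = .inl (l' ⟨x, hx⟩)) ∨
      ∃ hx : (x : G.V) ∉ B', k.left x = .inr ⟨x, x.2, hx⟩ := by
    intro x
    by_cases hx : (x : G.V) ∈ B'
    · exact .inl ⟨hx, by simp [k, m, s, ι, hx]⟩
    · exact .inr ⟨hx, by simp [k, m, s, hx]⟩
  have inl_eq : ∀ p (x : B), a p = x →
      Quot.mk (glueRel g k) (.inl p) = Quot.mk _ (.inr (k.left x)) := by
    intro p x hp
    obtain rfl : l x = p := ha ((hal x).trans hp.symm)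
    exact glue_sound g k x
  have inl_inl : ∀ p q, a p = a' q →
      Quot.mk (glueRel g k) (.inl p) = Quot.mk _ (.inr (.inl q)) := by
    intro p q hpq
    obtain ⟨hx, hx'⟩ := hA ⟨⟨p, rfl⟩, q, hpq.symm⟩
    rw [inl_eq p ⟨a p, hx⟩ rfl]
    rcases k_left ⟨a p, hx⟩ with ⟨hx', h⟩ | ⟨hx', -⟩
    · rw [h, ha' ((hal' ⟨a p, hx'⟩).trans hpq)]
    · contradiction
  have inl_inr : ∀ p (y : (B \ B' : Set G.V)), a p = y →
      Quot.mk (glueRel g k) (.inl p) = Quot.mk _ (.inr (.inr y)) := by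
    intro p y hp
    rw [inl_eq p ⟨y, y.2.1⟩ hp]
    rcases k_left ⟨y, y.2.1⟩ with ⟨hx', -⟩ | ⟨hx', h⟩
    · exact absurd hx' y.2.2
    · rw [h]
  have inl_ne_inr : ∀ q (y : (B \ B' : Set G.V)), a' q ≠ y := fun q y h =>
    y.2.2 (hA ⟨⟨l ⟨y, y.2.1⟩, hal _⟩, q, h⟩).2
  refine ⟨(g.comp k).apex, (g.comp k).left, Quot.lift (Sum.elim a (Sum.elim a' Subtype.val)) ?_,
    Sum.elim b (Sum.elim b' PEmpty.elim),
    (hH.comp hBw hk).congr ⟨.refl _, .refl _, fun e => (Set.image_id _).symm, fun _ => rfl,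
      fun y => (glue_sound g k y).symm⟩, ?_, ?_, ?_, ?_, ?_, hal⟩
  · rintro _ _ ⟨x, rfl, rfl⟩
    rcases k_left x with ⟨hx, h⟩ | ⟨hx, h⟩ <;> simp [g, h, hal, hal']
  · rintro ⟨p | p | p⟩ ⟨q | q | q⟩ h
    · obtain rfl : p = q := ha h
      rfl
    · exact inl_inl p q h
    · exact inl_inr p q h
    · exact (inl_inl q p h.symm).symm
    · obtain rfl : p = q := ha' h
      rfl
    · exact absurd h (inl_ne_inr p q)
    · exact (inl_inr q p h.symm).symm
    · exact absurd h.symm (inl_ne_inr q p)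
    · obtain rfl : p = q := Subtype.ext h
      rfl
  · refine hb.sumElim (hb'.sumElim (fun e => e.elim) fun _ e => e.elim) ?_
    rintro e (e' | e') h
    · exact Set.disjoint_left.1 hF ⟨e, rfl⟩ ⟨e', h.symm⟩
    · exact e'.elim
  · ext v
    constructor
    · rintro ⟨⟨p | p | p⟩, rfl⟩
      exacts [.inl ⟨p, rfl⟩, .inr ⟨p, rfl⟩, .inl ⟨l ⟨p, p.2.1⟩, hal _⟩]
    · rintro (⟨p, rfl⟩ | ⟨p, rfl⟩)
      exacts [⟨Quot.mk _ (.inl p), rfl⟩, ⟨Quot.mk _ (.inr (.inl p)), rfl⟩]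
  · rw [Set.Sum.elim_range, Set.Sum.elim_range, Set.range_eq_empty PEmpty.elim, Set.union_empty]
  · rintro (e | e | e)
    · change G.ends (b e) = _ '' ((fun p => Quot.mk _ (Sum.inl p)) '' H.ends e)
      rw [Set.image_image]
      exact hab e
    · change G.ends (b' e) = _ '' ((fun p => Quot.mk _ (Sum.inr p)) '' (Sum.inl '' H'.ends e))
      rw [Set.image_image, Set.image_image]
      exact hab' e
    · exact e.elim

/-- The running intersection property makes the parts of a tree decomposition on the two sides of
an edge overlap only in the bags at its ends, so they can be glued: induction on the edges of a
subforest `S` of the tree. -/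
theorem SubHasMonoidalWidth.of_le_tree (T : TreeDecomposition G) {w : ℕ}
    (hT : ∀ i, (T.bag i).ncard ≤ w) (n : G.E → T.Y) (hn : ∀ e, G.ends e ⊆ T.bag (n e))
    (S : SimpleGraph T.Y) (hS : S ≤ T.tree) (r : T.Y) :
    SubHasMonoidalWidth w (T.bag r) {v | ∃ i, S.Reachable r i ∧ v ∈ T.bag i}
      {e | S.Reachable r (n e)} := by
  induction hm : S.edgeSet.ncard using Nat.strong_induction_on generalizing S r with
  | _ m ih =>
  subst hm
  by_cases hr : ∃ c, S.Adj r c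
  · obtain ⟨c, hc⟩ := hr
    set S' := S.deleteEdges {s(r, c)}
    have hS' : S' ≤ S := S.deleteEdges_le _
    have hlt : S'.edgeSet.ncard < S.edgeSet.ncard := by
      refine Set.ncard_lt_ncard ⟨SimpleGraph.edgeSet_mono hS', fun h => ?_⟩
      have := h ((S.mem_edgeSet).2 hc)
      simp [S'] at this
    have hbridge : ¬ (T.tree.deleteEdges {s(r, c)}).Reachable r c :=
      SimpleGraph.isAcyclic_iff_forall_adj_isBridge.1 T.isTree.isAcyclic (hS hc)
    have hle : S' ≤ T.tree.deleteEdges {s(r, c)} := SimpleGraph.deleteEdges_mono hS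
    have hsplit : ∀ i, S.Reachable r i ↔ S'.Reachable r i ∨ S'.Reachable c i := by
      refine fun i => ⟨fun h => ?_, ?_⟩
      · rw [SimpleGraph.reachable_iff_reflTransGen] at h
        induction h with
        | refl => exact .inl .rfl
        | @tail i j _ hij ih =>
          by_cases he : s(i, j) = s(r, c)
          · rcases Sym2.eq_iff.1 he with ⟨-, rfl⟩ | ⟨-, rfl⟩
            exacts [.inr .rfl, .inl .rfl]
          · have : S'.Adj i j := by
              rw [SimpleGraph.deleteEdges_adj]; exact ⟨hij, he⟩
            exact ih.imp (·.trans this.reachable) (·.trans this.reachable)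
      · rintro (h | h)
        exacts [h.mono hS', hc.reachable.trans (h.mono hS')]
    have := (ih _ hlt S' (hS'.trans hS) r rfl).union (hT r) (hT c)
      (ih _ hlt S' (hS'.trans hS) c rfl) ?_ ?_
    · convert this using 1
      · ext v
        simp only [hsplit, Set.mem_ofPred_eq, Set.mem_union, or_and_right, exists_or]
      · ext e
        simp only [hsplit, Set.mem_ofPred_eq, Set.mem_union]
    · rintro v ⟨⟨i, hi, hvi⟩, j, hj, hvj⟩
      obtain ⟨p, hp⟩ := T.runningIntersection v i j hvi hvj
      have he : s(r, c) ∈ p.edges := by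
        by_contra he
        exact hbridge ((hi.mono hle).trans (.trans ⟨p.toDeleteEdge _ he⟩ (hj.symm.mono hle)))
      exact ⟨hp _ (p.fst_mem_support_of_mem_edges he), hp _ (p.snd_mem_support_of_mem_edges he)⟩
    · exact Set.disjoint_left.2 fun e h h' => hbridge ((h.trans h'.symm).mono hle)
  · have hreach : ∀ i, S.Reachable r i ↔ i = r := by
      refine fun i => ⟨fun ⟨p⟩ => ?_, fun h => h ▸ .rfl⟩
      cases p with
      | nil => rfl
      | cons h p => exact absurd ⟨_, h⟩ hr
    have := single (hT r) (F := {e | S.Reachable r (n e)})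
      fun e he => (hreach _).1 he ▸ hn e
    convert this using 1
    simp [hreach]

/-- The monoidal width of a hypergraph is at most its tree width. -/
theorem monoidalWidth_le_treeWidth (G : UHGraph.{u}) :
    monoidalWidth CospanUHGraph.weight G.toCospan ≤ G.treeWidth := by
  obtain ⟨T, hT⟩ := G.exists_treeDecomposition
  obtain ⟨r⟩ := T.isTree.connected.nonempty
  choose n hn using T.exists_ends_subset_bag
  obtain ⟨H, l, a, b, h, ha, hb, hra, hrb, hab, -⟩ :=
    SubHasMonoidalWidth.of_le_tree T hT n hn T.tree le_rfl r
  have hr : Nat.card (T.bag r) ≤ G.treeWidth := (Nat.card_coe_set_eq _).trans_le (hT r)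
  have ha' : a.Surjective := fun v => by
    obtain ⟨i, hi⟩ := T.exists_mem_bag v
    exact hra.ge ⟨i, T.isTree.connected.preconnected r i, hi⟩
  have hb' : b.Surjective := fun e => hrb.ge (T.isTree.connected.preconnected r (n e))
  obtain ⟨d, hd⟩ := (h.comp_legs hr hr (PEmpty.elim : PEmpty.{u + 1} → _)
    (PEmpty.elim : PEmpty.{u + 1} → _)).congr (h := ⟨G, PEmpty.elim, PEmpty.elim⟩)
    ⟨.ofBijective a ⟨ha, ha'⟩, .ofBijective b ⟨hb, hb'⟩, hab, fun x => x.elim, fun x => x.elim⟩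
  exact (ciInf_le' _ d).trans hd

end UHGraph

theorem mainTheorem2 (G : UHGraph.{u}) :
    G.treeWidth ≤ 3 * monoidalWidth CospanUHGraph.weight G.toCospan ∧
    monoidalWidth CospanUHGraph.weight G.toCospan ≤ G.treeWidth + 1 ∧
    monoidalWidth CospanUHGraph.weight G.toCospan ≤ 2 * G.treeWidth := by
  have h := G.monoidalWidth_le_treeWidth
  exact ⟨G.treeWidth_le_three_mul_monoidalWidth, by omega, by omega⟩
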